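/- **Proposition 6.1 (half-dressing on $\mathbb C^n\times\mathbb C^n$).** For $m\ge 0$ let $R_m$ be the standard r-matrix on $gl(m,\mathbb C)$: $R_mA$ is the strictly upper triangular part of $A$ minus the strictly lower triangular part of $A$. On $\mathbb C^{n\times d}\times\mathbb C^{d\times n}\ni(v,w^T)$ let $\{\cdot,\cdot\}_{n,d}$ be the bracket given, for functions $F,H$ holomorphic near $(v,w^T)$, by $$\{F,H\}_{n,d}(v,w^T)=\tfrac12\operatorname{tr}\Bigl(-(vx^T-\xi w^T)R_n(vy^T-\eta w^T)-(x^Tv-w^T\xi)R_d(y^Tv-w^T\eta)-w^Tv(y^T\xi-x^T\eta)-vw^T(\xi y^T-\eta x^T)+2\lambda(x^T\eta-y^T\xi)\Bigr)$$ with $\lambda=1$ (each summand being a square matrix of size $n$ or $d$, traced separately), where $x^T,y^T\in\mathbb C^{d\times n}$ and $\xi,\eta\in\mathbb C^{n\times d}$ are the derivatives determined by $dF(\dot v,\dot w^T)=\operatorname{tr}(x^T\dot v+\dot w^T\xi)$ and $dH(\dot v,\dot w^T)=\operatorname{tr}(y^T\dot v+\dot w^T\eta)$ at $(v,w^T)$.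 Note that $R_1=0$. For $k=1,\dots,d$ let $\Omega_k\subset\mathbb C^n\times\mathbb C^n$ be open, and let $\Phi^{(k)}_\pm:\Omega_k\to \mathrm{Mat}_{n\times n}(\mathbb C)$ be holomorphic with $\Phi^{(k)}_+$ upper triangular, $\Phi^{(k)}_-$ lower triangular, with mutually inverse diagonal parts, and $$\Phi^{(k)}_+(v,w^T)\,\Phi^{(k)}_-(v,w^T)^{-1}=1+vw^T\qquad\text{on }\Omega_k$$ (for example the same domain and the same choice of factors for every $k$). The half-dressing of $(v',w'^T)$ by $(v,w^T)\in\Omega_k$ is $(v,w^T)\cdot(v',w'^T)=(\Phi^{(k)}_+(v,w^T)v',\ w'^T\Phi^{(k)}_-(v,w^T)^{-1})$. On $U=\Omega_1\times\dots\times\Omega_d$ define the sequential half-dressing map $$\mathscr D:U\to\mathbb C^{n\times d}\times\mathbb C^{d\times n},\qquad \mathscr D(v_1,w_1^T;\dots;v_d,w_d^T)=(V,W^T),$$ where $V$ has columns $\tilde v_1,\dots,\tilde v_d$, $W^T$ has rows $\tilde w_1^T,\dots,\tilde w_d^T$, and $$(\tilde v_k,\tilde w_k^T)=(v_1,w_1^T)\cdot\bigl((v_2,w_2^T)\cdot(\cdots((v_{k-1},w_{k-1}^T)\cdot(v_k,w_k^T))\cdots)\bigr),\qquad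 (\tilde v_1,\tilde w_1^T)=(v_1,w_1^T).$$ Let $(\mathbb C^n\times\mathbb C^n)^d$ carry the direct sum $\{\cdot,\cdot\}_\oplus$ of $d$ copies of $\{\cdot,\cdot\}_{n,1}$. Then $U$ is open, $\mathscr D$ is holomorphic and injective on $U$ with open image and holomorphic inverse $\mathscr D(U)\to U$, and the bracket engendered by $\mathscr D$ on $\mathscr D(U)$ is $\{\cdot,\cdot\}_{n,d}$: for every $y\in\mathscr D(U)$ and all functions $F,H$ holomorphic near $y$ (complex differentiability at $y$ is enough), $$\{F\circ\mathscr D,\,H\circ\mathscr D\}_\oplus\bigl(\mathscr D^{-1}(y)\bigr)=\{F,H\}_{n,d}(y).$$ -/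

import Mathlib

open Matrix

attribute [local instance] Matrix.normedAddCommGroup Matrix.normedSpace

noncomputable section

/-- The space of pairs `(v, wᵀ)`, with `v` an `n × d` and `wᵀ` a `d × n` complex matrix.
For `d = 1` this is `ℂⁿ × ℂⁿ`, a pair consisting of a column and a row vector. -/
abbrev SpinSpace (n d : ℕ) : Type :=
  Matrix (Fin n) (Fin d) ℂ × Matrix (Fin d) (Fin n) ℂ

/-- The standard r-matrix on `gl(n, ℂ)`: the projection onto the strictly upper triangular
matrices minus the projection onto the strictly lower triangular matrices. -/
def standardR (n : ℕ) : Matrix (Fin n) (Fin n) ℂ →ₗ[ℂ] Matrix (Fin n) (Fin n) ℂ where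
  toFun A := Matrix.of fun i j => if i < j then A i j else if j < i then -A i j else 0
  map_add' A B := by
    ext i j
    simp only [Matrix.of_apply, Matrix.add_apply]
    split_ifs <;> ring
  map_smul' c A := by
    ext i j
    simp only [Matrix.of_apply, Matrix.smul_apply, RingHom.id_apply, smul_eq_mul]
    split_ifs <;> ring

/-- The partial derivative `xᵀ = δ_v F`: the `d × n` matrix such that
`dF (v̇, 0) = tr (xᵀ v̇)`. -/
def deltaV {n d : ℕ} (F : SpinSpace n d → ℂ) (m : SpinSpace n d) :
    Matrix (Fin d) (Fin n) ℂ :=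
  Matrix.of fun k i => fderiv ℂ F m (Matrix.single i k 1, 0)

/-- The partial derivative `ξ = δ_{wᵀ} F`: the `n × d` matrix such that
`dF (0, ẇᵀ) = tr (ẇᵀ ξ)`. -/
def deltaW {n d : ℕ} (F : SpinSpace n d → ℂ) (m : SpinSpace n d) :
    Matrix (Fin n) (Fin d) ℂ :=
  Matrix.of fun i k => fderiv ℂ F m (0, Matrix.single k i 1)

/-- The bivector at the point `(v, wᵀ)`, evaluated on the covectors `(xᵀ, ξ)` and `(yᵀ, η)`. -/
def zakForm {n d : ℕ} (R : Matrix (Fin n) (Fin n) ℂ →ₗ[ℂ] Matrix (Fin n) (Fin n) ℂ)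
    (ρ : Matrix (Fin d) (Fin d) ℂ →ₗ[ℂ] Matrix (Fin d) (Fin d) ℂ) (lam : ℂ)
    (v : Matrix (Fin n) (Fin d) ℂ) (wT : Matrix (Fin d) (Fin n) ℂ)
    (xT : Matrix (Fin d) (Fin n) ℂ) (ξ : Matrix (Fin n) (Fin d) ℂ)
    (yT : Matrix (Fin d) (Fin n) ℂ) (η : Matrix (Fin n) (Fin d) ℂ) : ℂ :=
  (1 / 2 : ℂ) *
    (- trace ((v * xT - ξ * wT) * R (v * yT - η * wT))
      - trace ((xT * v - wT * ξ) * ρ (yT * v - wT * η))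
      - trace (wT * v * (yT * ξ - xT * η))
      - trace (v * wT * (ξ * yT - η * xT))
      + 2 * lam * trace (xT * η - yT * ξ))

/-- The bracket on `SpinSpace n d` with r-matrices `R`, `ρ` and parameter `lam`. -/
def zakBracket {n d : ℕ} (R : Matrix (Fin n) (Fin n) ℂ →ₗ[ℂ] Matrix (Fin n) (Fin n) ℂ)
    (ρ : Matrix (Fin d) (Fin d) ℂ →ₗ[ℂ] Matrix (Fin d) (Fin d) ℂ) (lam : ℂ)
    (F H : SpinSpace n d → ℂ) (m : SpinSpace n d) : ℂ :=
  zakForm R ρ lam m.1 m.2 (deltaV F m) (deltaW F m) (deltaV H m) (deltaW H m)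

/-- The direct sum, on `(ℂⁿ × ℂⁿ)ᵈ`, of `d` copies of the bracket on `ℂⁿ × ℂⁿ` with `lam = 1`. -/
def directSumBracket {n d : ℕ} (F H : (Fin d → SpinSpace n 1) → ℂ)
    (x : Fin d → SpinSpace n 1) : ℂ :=
  ∑ k, zakBracket (standardR n) (standardR 1) 1
    (fun m => F (Function.update x k m)) (fun m => H (Function.update x k m)) (x k)

/-- A holomorphic choice, on an open set of pairs `(v, wᵀ)`, of the factorization
`1 + v wᵀ = Φ₊ Φ₋⁻¹`, with `Φ₊` upper triangular, `Φ₋` lower triangular, and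
mutually inverse diagonal parts (so that `Φ₊` and `Φ₋⁻¹` have the same diagonal part;
both factors are then automatically invertible). -/
structure FactorizationBranch (n : ℕ) where
  domain : Set (SpinSpace n 1)
  isOpen_domain : IsOpen domain
  plus : SpinSpace n 1 → Matrix (Fin n) (Fin n) ℂ
  minus : SpinSpace n 1 → Matrix (Fin n) (Fin n) ℂ
  holo_plus : DifferentiableOn ℂ plus domain
  holo_minus : DifferentiableOn ℂ minus domain
  plus_upper : ∀ m ∈ domain, ∀ i j, j < i → plus m i j = 0
  minus_lower : ∀ m ∈ domain, ∀ i j, i < j → minus m i j = 0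
  diag_mul : ∀ m ∈ domain, ∀ i, plus m i i * minus m i i = 1
  factor : ∀ m ∈ domain, plus m * (minus m)⁻¹ = 1 + m.1 * m.2

/-- The half-dressing of `m'` by `m`: `m · m' = (Φ₊(m) v', w'ᵀ Φ₋(m)⁻¹)`. -/
def halfDress {n : ℕ} (B : FactorizationBranch n) (m m' : SpinSpace n 1) : SpinSpace n 1 :=
  (B.plus m * m'.1, m'.2 * (B.minus m)⁻¹)

/-- Sequential half-dressing: the first pair is unchanged, and the `k`-th pair becomes
`x₁ · (x₂ · (⋯ (xₖ₋₁ · xₖ)))`. -/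
def seqHalfDress {n : ℕ} : {d : ℕ} → (Fin d → FactorizationBranch n) →
    (Fin d → SpinSpace n 1) → Fin d → SpinSpace n 1
  | 0, _, x => x
  | _ + 1, B, x =>
      Fin.cons (x 0) fun k => halfDress (B 0) (x 0) (seqHalfDress (Fin.tail B) (Fin.tail x) k)

/-- The half-dressing map `(ℂⁿ × ℂⁿ)ᵈ → ℂ^{n × d} × ℂ^{d × n}`: the dressed vectors `ṽₖ` are the
columns of `V`, and the dressed `w̃ₖᵀ` are the rows of `Wᵀ`. -/
def halfDressing {n d : ℕ} (B : Fin d → FactorizationBranch n) (x : Fin d → SpinSpace n 1) :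
    SpinSpace n d :=
  (Matrix.of fun i k => (seqHalfDress B x k).1 i 0,
    Matrix.of fun k i => (seqHalfDress B x k).2 0 i)

/-- The set of collections in `(ℂⁿ × ℂⁿ)ᵈ` on which the half-dressing map is defined. -/
def dressingDomain {n d : ℕ} (B : Fin d → FactorizationBranch n) :
    Set (Fin d → SpinSpace n 1) :=
  {x | ∀ k, x k ∈ (B k).domain}

/-- The bracket at a point `y` of the image `D '' U` that is engendered by the direct sum bracket
through a map `D`, injective on `U`: pull both functions back, take their bracket, and evaluate it
at the preimage of `y`. -/
def engenderedBracket {n d : ℕ} (D : (Fin d → SpinSpace n 1) → SpinSpace n d)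
    (U : Set (Fin d → SpinSpace n 1)) (F H : SpinSpace n d → ℂ) (y : SpinSpace n d) : ℂ :=
  directSumBracket (F ∘ D) (H ∘ D) (Function.invFunOn D U y)

end

/-!
The map is built one pair at a time: with `m = x₀`, `P = Φ₊(m)` and `N = Φ₋(m)⁻¹`, the image of
`(x₀, …, x_d)` consists of `m` followed by `(P V', W' N)`, where `(V', W')` is the image of
`(x₁, …, x_d)`. Everything is an induction on this step.

*Inverse.* The pair `m` is read off from the image, and the rest is multiplied by `P⁻¹` and `N⁻¹`.
The matrices `P` and `N` are triangular with nonvanishing diagonal entries, so these inverses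
exist and depend holomorphically on `m`; the image is open because it is the preimage of an open
set under the undressing map (`exists_halfDressing_inverse`).

*Bracket.* A covector of the `d + 1` pairs has to be pulled back along one step. To the dressed
pairs it pulls back by multiplication with `P` and `N`. To the dressing pair, differentiating
`P N = 1 + v wᵀ` gives `P⁻¹ dP + dN N⁻¹ = P⁻¹ (dv wᵀ + v dwᵀ) N⁻¹`, where `P⁻¹ dP` is upper
triangular, `dN N⁻¹` is lower triangular and both have the same diagonal. Hence the two terms are
the halves `(1 ± R)/2` of the right side, and by the skew-symmetry of `R` the covector `(xᵀ, ξ)`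
becomes `(xᵀ + wᵀ T, ξ + T v)` for an explicit matrix `T`
(`FactorizationBranch.trace_fderiv_factors`).

The bivectors then agree by `trace_dressing_identity`. With `E = b - a` the difference of the moment
matrices of the dressed pairs, the matrix entering the `R_n` term of the dressing pair differs from
that of all `d + 1` pairs by `U + L`, where `U = P E₊ P⁻¹` is upper triangular, `L = N⁻¹ E₋ N` is
lower triangular and `U`, `L` have the same diagonal, so that `R (U + L) = U - L`. Since also
`U = (1 + v wᵀ) T - M` and `L = J - T (1 + v wᵀ)` are polynomial in the remaining data, what is left
is an identity between traces of words, valid up to cyclic rotation, once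
`tr (U U') = tr (L L')` is taken into account.
-/

/-! ### Differential calculus of matrix-valued functions -/

section MatrixCalculus

variable {E : Type*} [NormedAddCommGroup E] [NormedSpace ℂ E]

theorem fderiv_prodMk_apply {G G' : Type*} [NormedAddCommGroup G] [NormedSpace ℂ G]
    [NormedAddCommGroup G'] [NormedSpace ℂ G'] {f : E → G} {g : E → G'} {x : E}
    (hf : DifferentiableAt ℂ f x) (hg : DifferentiableAt ℂ g x) (h : E) :
    fderiv ℂ (fun y => (f y, g y)) x h = (fderiv ℂ f x h, fderiv ℂ g x h) := by
  rw [hf.fderiv_prodMk hg, ContinuousLinearMap.prod_apply]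

theorem Filter.EventuallyEq.fderiv_apply_eq {G : Type*} [NormedAddCommGroup G] [NormedSpace ℂ G]
    {f g : E → G} {x : E} (hfg : f =ᶠ[nhds x] g) (h : E) :
    fderiv ℂ f x h = fderiv ℂ g x h := by
  rw [hfg.fderiv_eq]

theorem fderiv_const_fun_apply {G : Type*} [NormedAddCommGroup G] [NormedSpace ℂ G] (c : G) (x h : E) :
    fderiv ℂ (fun _ => c) x h = 0 := by
  rw [(hasFDerivAt_const c x).fderiv, _root_.zero_apply]

theorem fderiv_comp_clm_apply {G G' : Type*} [NormedAddCommGroup G] [NormedSpace ℂ G]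
    [NormedAddCommGroup G'] [NormedSpace ℂ G'] {F : G' → ℂ} {L : G →L[ℂ] G'} {f : E → G} {x : E}
    (hF : DifferentiableAt ℂ F (L (f x))) (hf : DifferentiableAt ℂ f x) (h : E) :
    fderiv ℂ (fun y => F (L (f y))) x h = fderiv ℂ F (L (f x)) (L (fderiv ℂ f x h)) := by
  have := hF.hasFDerivAt.comp x (L.hasFDerivAt.comp x hf.hasFDerivAt)
  change HasFDerivAt (fun y => F (L (f y))) _ x at this
  rw [this.fderiv]
  rfl

/-- The product rule for matrix products. Matrices carry the entrywise sup norm here, which is not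
submultiplicative, so the rule is that of a bounded bilinear map and not of a normed algebra. -/
theorem hasFDerivAt_matrix_mul {l m p : ℕ}
    {f : E → Matrix (Fin l) (Fin m) ℂ} {g : E → Matrix (Fin m) (Fin p) ℂ}
    {f' : E →L[ℂ] Matrix (Fin l) (Fin m) ℂ} {g' : E →L[ℂ] Matrix (Fin m) (Fin p) ℂ} {x : E}
    (hf : HasFDerivAt f f' x) (hg : HasFDerivAt g g' x) :
    ∃ D : E →L[ℂ] Matrix (Fin l) (Fin p) ℂ, HasFDerivAt (fun y => f y * g y) D x ∧
      ∀ h, D h = f x * g' h + f' h * g x :=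
  ⟨_, (mulLinearMap ℂ (l := Fin l) (m := Fin m) (n := Fin p)
      (A := ℂ)).toContinuousBilinearMap.hasFDerivAt_of_bilinear hf hg, fun _ => rfl⟩

theorem DifferentiableAt.matrix_mul {l m p : ℕ}
    {f : E → Matrix (Fin l) (Fin m) ℂ} {g : E → Matrix (Fin m) (Fin p) ℂ} {x : E}
    (hf : DifferentiableAt ℂ f x) (hg : DifferentiableAt ℂ g x) :
    DifferentiableAt ℂ (fun y => f y * g y) x :=
  let ⟨_, h, _⟩ := hasFDerivAt_matrix_mul hf.hasFDerivAt hg.hasFDerivAt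
  h.differentiableAt

theorem fderiv_matrix_mul {l m p : ℕ}
    {f : E → Matrix (Fin l) (Fin m) ℂ} {g : E → Matrix (Fin m) (Fin p) ℂ} {x : E}
    (hf : DifferentiableAt ℂ f x) (hg : DifferentiableAt ℂ g x) (h : E) :
    fderiv ℂ (fun y => f y * g y) x h = f x * fderiv ℂ g x h + fderiv ℂ f x h * g x := by
  obtain ⟨D, hD, hD'⟩ := hasFDerivAt_matrix_mul hf.hasFDerivAt hg.hasFDerivAt
  rw [hD.fderiv, hD']

theorem fderiv_const_matrix_mul {l m p : ℕ} (A : Matrix (Fin l) (Fin m) ℂ)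
    {g : E → Matrix (Fin m) (Fin p) ℂ} {x : E} (hg : DifferentiableAt ℂ g x) (h : E) :
    fderiv ℂ (fun y => A * g y) x h = A * fderiv ℂ g x h := by
  rw [fderiv_matrix_mul (differentiableAt_const A) hg, (hasFDerivAt_const A x).fderiv,
    _root_.zero_apply, Matrix.zero_mul, add_zero]

theorem fderiv_matrix_mul_const {l m p : ℕ} (A : Matrix (Fin m) (Fin p) ℂ)
    {f : E → Matrix (Fin l) (Fin m) ℂ} {x : E} (hf : DifferentiableAt ℂ f x) (h : E) :
    fderiv ℂ (fun y => f y * A) x h = fderiv ℂ f x h * A := by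
  rw [fderiv_matrix_mul hf (differentiableAt_const A), (hasFDerivAt_const A x).fderiv,
    _root_.zero_apply, Matrix.mul_zero, zero_add]

theorem differentiableAt_matrix {l m : ℕ} {f : E → Matrix (Fin l) (Fin m) ℂ} {x : E} :
    DifferentiableAt ℂ f x ↔ ∀ i j, DifferentiableAt ℂ (fun y => f y i j) x :=
  (differentiableAt_pi (Φ := f)).trans (forall_congr' fun _ => differentiableAt_pi)

theorem fderiv_matrix_apply {l m : ℕ} {f : E → Matrix (Fin l) (Fin m) ℂ} {x : E}
    (hf : DifferentiableAt ℂ f x) (h : E) (i : Fin l) (j : Fin m) :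
    fderiv ℂ f x h i j = fderiv ℂ (fun y => f y i j) x h := by
  have h1 := hasFDerivAt_pi'.1 (hasFDerivAt_pi'.1 hf.hasFDerivAt i) j
  rw [h1.fderiv]
  rfl

theorem DifferentiableAt.matrix_det {n : ℕ} {f : E → Matrix (Fin n) (Fin n) ℂ} {x : E}
    (hf : DifferentiableAt ℂ f x) : DifferentiableAt ℂ (fun y => (f y).det) x := by
  simp only [det_apply']
  have := differentiableAt_matrix.1 hf
  fun_prop

theorem DifferentiableAt.matrix_inv {n : ℕ} {f : E → Matrix (Fin n) (Fin n) ℂ} {x : E}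
    (hf : DifferentiableAt ℂ f x) (h0 : (f x).det ≠ 0) :
    DifferentiableAt ℂ (fun y => (f y)⁻¹) x := by
  have hij := differentiableAt_matrix.1 hf
  refine differentiableAt_matrix.2 fun i j => ?_
  simp only [inv_def, Ring.inverse_eq_inv', Matrix.smul_apply, smul_eq_mul, adjugate_apply]
  refine (hf.matrix_det.inv h0).mul (DifferentiableAt.matrix_det ?_)
  refine differentiableAt_matrix.2 fun k l => ?_
  by_cases hk : k = j
  · subst hk; simp
  · simpa [updateRow_ne hk] using hij k l

end MatrixCalculus

/-! ### Triangular matrices and the standard r-matrix -/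

theorem standardR_apply {n : ℕ} (A : Matrix (Fin n) (Fin n) ℂ) (i j : Fin n) :
    standardR n A i j = if i < j then A i j else if j < i then -A i j else 0 := rfl

theorem trace_mul_eq_sum {l m : ℕ} (A : Matrix (Fin l) (Fin m) ℂ) (B : Matrix (Fin m) (Fin l) ℂ) :
    trace (A * B) = ∑ i, ∑ j, A i j * B j i := by
  simp [trace, Matrix.mul_apply]

/-- The standard r-matrix is skew-symmetric for the trace form. -/
theorem trace_mul_standardR {n : ℕ} (A B : Matrix (Fin n) (Fin n) ℂ) :
    trace (A * standardR n B) = -trace (standardR n A * B) := by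
  simp only [trace_mul_eq_sum, ← Finset.sum_neg_distrib]
  refine Finset.sum_congr rfl fun i _ => Finset.sum_congr rfl fun j _ => ?_
  rcases lt_trichotomy i j with h | h | h
  · simp [standardR_apply, h, h.not_gt]
  · simp [standardR_apply, h]
  · simp [standardR_apply, h, h.not_gt]

/-- The strictly upper triangular part plus half of the diagonal part. -/
noncomputable def upperHalf {n : ℕ} (A : Matrix (Fin n) (Fin n) ℂ) : Matrix (Fin n) (Fin n) ℂ :=
  (1 / 2 : ℂ) • (A + standardR n A)

/-- The strictly lower triangular part plus half of the diagonal part. -/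
noncomputable def lowerHalf {n : ℕ} (A : Matrix (Fin n) (Fin n) ℂ) : Matrix (Fin n) (Fin n) ℂ :=
  (1 / 2 : ℂ) • (A - standardR n A)

section Halves

variable {n : ℕ} (A B : Matrix (Fin n) (Fin n) ℂ)

theorem upperHalf_add_lowerHalf : upperHalf A + lowerHalf A = A := by
  simp only [upperHalf, lowerHalf, ← smul_add]
  rw [show A + standardR n A + (A - standardR n A) = (2 : ℂ) • A by rw [two_smul]; abel, smul_smul]
  norm_num

theorem standardR_eq_sub : standardR n A = upperHalf A - lowerHalf A := by
  simp only [upperHalf, lowerHalf, ← smul_sub]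
  rw [show A + standardR n A - (A - standardR n A) = (2 : ℂ) • standardR n A by
    rw [two_smul]; abel, smul_smul]
  norm_num

theorem upperHalf_sub : upperHalf (A - B) = upperHalf A - upperHalf B := by
  simp only [upperHalf, map_sub, ← smul_sub]
  congr 1; abel

theorem lowerHalf_sub : lowerHalf (A - B) = lowerHalf A - lowerHalf B := by
  simp only [lowerHalf, map_sub, ← smul_sub]
  congr 1; abel

theorem upperHalf_isUpperTriangular : (upperHalf A).IsUpperTriangular := fun i j (h : j < i) => by
  simp [upperHalf, standardR_apply, h, h.not_gt]

theorem lowerHalf_isLowerTriangular : (lowerHalf A).IsLowerTriangular := fun i j h => by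
  have h : i < j := h
  simp [lowerHalf, standardR_apply, h]

theorem upperHalf_diag (i : Fin n) : upperHalf A i i = lowerHalf A i i := by
  simp [upperHalf, lowerHalf, standardR_apply]

variable {A B}

theorem standardR_upper_add_lower (hA : A.IsUpperTriangular) (hB : B.IsLowerTriangular)
    (h : ∀ i, A i i = B i i) : standardR n (A + B) = A - B := by
  ext i j
  rcases lt_trichotomy i j with hij | hij | hij
  · simp [standardR_apply, hij, hB hij]
  · simp [standardR_apply, hij, h]
  · simp [standardR_apply, hij, hij.not_gt, hA hij]

theorem upperHalf_upper_add_lower (hA : A.IsUpperTriangular) (hB : B.IsLowerTriangular)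
    (h : ∀ i, A i i = B i i) : upperHalf (A + B) = A := by
  rw [upperHalf, standardR_upper_add_lower hA hB h, show A + B + (A - B) = (2 : ℂ) • A by
    rw [two_smul]; abel, smul_smul]
  norm_num

theorem lowerHalf_upper_add_lower (hA : A.IsUpperTriangular) (hB : B.IsLowerTriangular)
    (h : ∀ i, A i i = B i i) : lowerHalf (A + B) = B := by
  rw [lowerHalf, standardR_upper_add_lower hA hB h, show A + B - (A - B) = (2 : ℂ) • B by
    rw [two_smul]; abel, smul_smul]
  norm_num

variable (A B)

theorem trace_mul_upperHalf : trace (A * upperHalf B) = trace (lowerHalf A * B) := by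
  simp only [upperHalf, lowerHalf, mul_smul_comm, smul_mul_assoc, mul_add, add_mul, trace_smul,
    trace_add, trace_mul_standardR, sub_eq_add_neg, neg_mul, trace_neg]

theorem trace_mul_lowerHalf : trace (A * lowerHalf B) = trace (upperHalf A * B) := by
  simp only [upperHalf, lowerHalf, mul_smul_comm, smul_mul_assoc, mul_sub, add_mul, trace_smul,
    trace_add, trace_sub, trace_mul_standardR, sub_neg_eq_add]

variable {A B}

theorem Matrix.IsUpperTriangular.mul_diag (hA : A.IsUpperTriangular) (hB : B.IsUpperTriangular)
    (i : Fin n) : (A * B) i i = A i i * B i i := by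
  rw [Matrix.mul_apply, Finset.sum_eq_single i]
  · intro j _ hj
    rcases hj.lt_or_gt with h | h
    · rw [hA h, zero_mul]
    · rw [hB h, mul_zero]
  · simp

theorem Matrix.IsLowerTriangular.mul_diag (hA : A.IsLowerTriangular) (hB : B.IsLowerTriangular)
    (i : Fin n) : (A * B) i i = A i i * B i i := by
  rw [Matrix.mul_apply, Finset.sum_eq_single i]
  · intro j _ hj
    rcases hj.lt_or_gt with h | h
    · rw [hB h, mul_zero]
    · rw [hA h, zero_mul]
  · simp

/-- Conjugation by a triangular matrix preserves triangularity and the diagonal part. -/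
theorem Matrix.IsUpperTriangular.conj {P Q : Matrix (Fin n) (Fin n) ℂ} (hP : P.IsUpperTriangular)
    (hPQ : P * Q = 1) (hA : A.IsUpperTriangular) :
    (P * A * Q).IsUpperTriangular ∧ ∀ i, (P * A * Q) i i = A i i := by
  have hQ : Q.IsUpperTriangular := by
    have := invertibleOfRightInverse P Q hPQ
    rw [← inv_eq_right_inv hPQ]
    exact blockTriangular_inv_of_blockTriangular hP
  have h1 (i) : P i i * Q i i = 1 := by rw [← hP.mul_diag hQ, hPQ, one_apply_eq]
  refine ⟨(hP.mul hA).mul hQ, fun i => ?_⟩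
  rw [IsUpperTriangular.mul_diag (hP.mul hA) hQ, hP.mul_diag hA]
  linear_combination A i i * h1 i

theorem Matrix.IsLowerTriangular.conj {P Q : Matrix (Fin n) (Fin n) ℂ} (hQ : Q.IsLowerTriangular)
    (hPQ : P * Q = 1) (hA : A.IsLowerTriangular) :
    (P * A * Q).IsLowerTriangular ∧ ∀ i, (P * A * Q) i i = A i i := by
  have hP : P.IsLowerTriangular := by
    have := invertibleOfLeftInverse Q P hPQ
    rw [← inv_eq_left_inv hPQ]
    exact blockTriangular_inv_of_blockTriangular hQ
  have h1 (i) : P i i * Q i i = 1 := by rw [← hP.mul_diag hQ, hPQ, one_apply_eq]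
  refine ⟨(hP.mul hA).mul hQ, fun i => ?_⟩
  rw [IsLowerTriangular.mul_diag (hP.mul hA) hQ, hP.mul_diag hA]
  linear_combination A i i * h1 i

/-- If `U + L` and `U' + L'` are split into an upper and a lower triangular matrix with the same
diagonal, the trace form does not distinguish the upper parts from the lower parts. -/
theorem trace_upper_mul_eq_trace_lower_mul {U L U' L' : Matrix (Fin n) (Fin n) ℂ}
    (hU : U.IsUpperTriangular) (hL : L.IsLowerTriangular) (h : ∀ i, U i i = L i i)
    (hU' : U'.IsUpperTriangular) (hL' : L'.IsLowerTriangular) (h' : ∀ i, U' i i = L' i i) :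
    trace (U * U') = trace (L * L') := by
  simp only [trace, diag_apply]
  refine Finset.sum_congr rfl fun i _ => ?_
  rw [hU.mul_diag hU', hL.mul_diag hL', h, h']

/-- The change of the r-matrix form when its arguments are shifted by `U + L` and `U' + L'`. -/
theorem trace_standardR_add_triangular {U L U' L' : Matrix (Fin n) (Fin n) ℂ}
    (hU : U.IsUpperTriangular) (hL : L.IsLowerTriangular) (h : ∀ i, U i i = L i i)
    (hU' : U'.IsUpperTriangular) (hL' : L'.IsLowerTriangular) (h' : ∀ i, U' i i = L' i i)
    (K K' : Matrix (Fin n) (Fin n) ℂ) :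
    trace ((K + (U + L)) * standardR n (K' + (U' + L'))) =
      trace (K * standardR n K') + trace (K * (U' - L')) - trace ((U - L) * K')
        + trace (L * U') - trace (U * L') := by
  have h1 : trace ((U + L) * standardR n K') = -trace ((U - L) * K') := by
    rw [trace_mul_standardR, standardR_upper_add_lower hU hL h]
  have h2 := trace_upper_mul_eq_trace_lower_mul hU hL h hU' hL' h'
  rw [map_add, standardR_upper_add_lower hU' hL' h', add_mul, mul_add, mul_add, trace_add,
    trace_add, trace_add, h1]
  simp only [mul_sub, sub_mul, add_mul, trace_add, trace_sub]
  linear_combination h2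

end Halves

/-! ### The trace identity for half-dressing -/

/-- The matrix `T` by which a covector `(xᵀ, ξ)` of the dressing pair `(v, wᵀ)` is shifted to
`(xᵀ + wᵀ T, ξ + T v)` under pullback. Here `P'` and `N'` are the inverses of the factors `P = Φ₊` and
`N = Φ₋⁻¹`, and `a = v xᵀ`, `b = ξ wᵀ` are the moment matrices of the undressed pairs. -/
noncomputable def dressShift {n : ℕ} (P' N' a b : Matrix (Fin n) (Fin n) ℂ) :
    Matrix (Fin n) (Fin n) ℂ :=
  N' * (lowerHalf a + upperHalf b) * P'

section Identity

variable {n : ℕ} {P P' N N' : Matrix (Fin n) (Fin n) ℂ}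

theorem conj_upperHalf_sub (hN : N * N' = 1) (a b : Matrix (Fin n) (Fin n) ℂ) :
    P * upperHalf (b - a) * P' = P * N * dressShift P' N' a b - P * a * P' := by
  have h : lowerHalf a + upperHalf b = a + upperHalf (b - a) := by
    rw [upperHalf_sub]; nth_rw 2 [← upperHalf_add_lowerHalf a]; abel
  have : P * N * dressShift P' N' a b = P * (N * N') * (lowerHalf a + upperHalf b) * P' := by
    simp only [dressShift, mul_assoc]
  rw [this, hN, h]
  noncomm_ring

theorem conj_lowerHalf_sub (hP : P' * P = 1) (a b : Matrix (Fin n) (Fin n) ℂ) :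
    N' * lowerHalf (b - a) * N = N' * b * N - dressShift P' N' a b * (P * N) := by
  have h : lowerHalf a + upperHalf b = b - lowerHalf (b - a) := by
    rw [lowerHalf_sub]; nth_rw 2 [← upperHalf_add_lowerHalf b]; abel
  have : dressShift P' N' a b * (P * N) =
      N' * (lowerHalf a + upperHalf b) * (P' * P) * N := by
    simp only [dressShift, mul_assoc]
  rw [this, hP, h]
  noncomm_ring

/-- The trace identity behind the Poisson property of half-dressing. The letters stand for the
`n × n` products of the data, a subscript `₂` marking the second covector. With `(v, wᵀ)` the
dressing pair and `(V, Wᵀ)` the dressed ones, `p = v wᵀ`, `A = v xᵀ`, `B = ξ wᵀ`, `C = ξ yᵀ`,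
`C₂ = η xᵀ`, while `Q = V Wᵀ`, `M = V Xᵀ`, `J = Ξ Wᵀ`, `Z = Ξ Yᵀ`, `Z₂ = Η Xᵀ`, and `a`, `b` are `M`, `J`
before dressing. The `R_d` terms are equal on both sides and are left out. -/
theorem trace_dressing_identity (hPu : P.IsUpperTriangular) (hNl : N.IsLowerTriangular)
    (hP : P * P' = 1) (hP2 : P' * P = 1) (hN : N * N' = 1) (hN2 : N' * N = 1)
    {p : Matrix (Fin n) (Fin n) ℂ} (hg : P * N = 1 + p)
    (A A₂ B B₂ C C₂ Q Z Z₂ a a₂ b b₂ M M₂ J J₂ T T₂ : Matrix (Fin n) (Fin n) ℂ)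
    (hM : M = P * a * P') (hM₂ : M₂ = P * a₂ * P') (hJ : J = N' * b * N) (hJ₂ : J₂ = N' * b₂ * N)
    (hT : T = dressShift P' N' a b) (hT₂ : T₂ = dressShift P' N' a₂ b₂) :
    (-trace ((A + p * T - (B + T * p)) * standardR n (A₂ + p * T₂ - (B₂ + T₂ * p)))
      - trace ((A₂ + p * T₂) * (B + T * p)) + trace ((A + p * T) * (B₂ + T₂ * p))
      - trace (p * (C + T * A₂ + B * T₂ + T * p * T₂ - (C₂ + T₂ * A + B₂ * T + T₂ * p * T)))
      + 2 * trace (C₂ + T₂ * A + B₂ * T + T₂ * p * T - (C + T * A₂ + B * T₂ + T * p * T₂)))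
    + (-trace ((a - b) * standardR n (a₂ - b₂)) - trace (a₂ * b) + trace (a * b₂)
      - trace (Q * (Z - Z₂)) + 2 * trace (P * N * (Z₂ - Z)))
    = -trace ((A + M - (B + J)) * standardR n (A₂ + M₂ - (B₂ + J₂)))
      - (trace (M * A₂) - trace (Z₂ * p) - trace (Q * C) + trace (J₂ * B))
      + (trace (A * M₂) - trace (Q * C₂) - trace (p * Z) + trace (B₂ * J))
      - trace ((A₂ + M₂) * (B + J)) + trace ((A + M) * (B₂ + J₂))
      - trace ((p + Q) * (C + Z - (C₂ + Z₂))) + 2 * trace (C₂ + Z₂ - (C + Z)) := by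
  have hU : P * upperHalf (b - a) * P' = (1 + p) * T - M := by
    rw [conj_upperHalf_sub hN, hT, hM, hg]
  have hU₂ : P * upperHalf (b₂ - a₂) * P' = (1 + p) * T₂ - M₂ := by
    rw [conj_upperHalf_sub hN, hT₂, hM₂, hg]
  have hL : N' * lowerHalf (b - a) * N = J - T * (1 + p) := by
    rw [conj_lowerHalf_sub hP2, hT, hJ, hg]
  have hL₂ : N' * lowerHalf (b₂ - a₂) * N = J₂ - T₂ * (1 + p) := by
    rw [conj_lowerHalf_sub hP2, hT₂, hJ₂, hg]
  obtain ⟨hUt, hUd⟩ := hPu.conj hP (upperHalf_isUpperTriangular (b - a))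
  obtain ⟨hUt₂, hUd₂⟩ := hPu.conj hP (upperHalf_isUpperTriangular (b₂ - a₂))
  obtain ⟨hLt, hLd⟩ := hNl.conj hN2 (lowerHalf_isLowerTriangular (b - a))
  obtain ⟨hLt₂, hLd₂⟩ := hNl.conj hN2 (lowerHalf_isLowerTriangular (b₂ - a₂))
  have hd (i) : ((1 + p) * T - M) i i = (J - T * (1 + p)) i i := by
    rw [← hU, ← hL, hUd, hLd, upperHalf_diag]
  have hd₂ (i) : ((1 + p) * T₂ - M₂) i i = (J₂ - T₂ * (1 + p)) i i := by
    rw [← hU₂, ← hL₂, hUd₂, hLd₂, upperHalf_diag]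
  rw [hU] at hUt
  rw [hU₂] at hUt₂
  rw [hL] at hLt
  rw [hL₂] at hLt₂
  -- the `r`-matrix term of the dressing pair
  have hR := trace_standardR_add_triangular hUt hLt hd hUt₂ hLt₂ hd₂
    (A + M - (B + J)) (A₂ + M₂ - (B₂ + J₂))
  have e1 : A + p * T - (B + T * p) =
      A + M - (B + J) + ((1 + p) * T - M + (J - T * (1 + p))) := by noncomm_ring
  have e2 : A₂ + p * T₂ - (B₂ + T₂ * p) =
      A₂ + M₂ - (B₂ + J₂) + ((1 + p) * T₂ - M₂ + (J₂ - T₂ * (1 + p))) := by noncomm_ring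
  rw [← e1, ← e2] at hR
  have hUL := trace_upper_mul_eq_trace_lower_mul hUt hLt hd hUt₂ hLt₂ hd₂
  -- the `r`-matrix term of the dressed pairs
  have hE : trace ((a - b) * standardR n (a₂ - b₂)) =
      trace (P * (b - a) * P' * ((1 + p) * T₂ - M₂))
        - trace (N' * (b - a) * N * (J₂ - T₂ * (1 + p))) := by
    have c1 : trace (P * (b - a) * P' * (P * upperHalf (b₂ - a₂) * P'))
        = trace ((b - a) * upperHalf (b₂ - a₂)) := by
      rw [show P * (b - a) * P' * (P * upperHalf (b₂ - a₂) * P') =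
        P * ((b - a) * (P' * P) * upperHalf (b₂ - a₂) * P') by simp only [mul_assoc],
        trace_mul_comm, hP2, mul_one, mul_assoc _ P', hP2, mul_one]
    have c2 : trace (N' * (b - a) * N * (N' * lowerHalf (b₂ - a₂) * N))
        = trace ((b - a) * lowerHalf (b₂ - a₂)) := by
      rw [show N' * (b - a) * N * (N' * lowerHalf (b₂ - a₂) * N) =
        N' * ((b - a) * (N * N') * lowerHalf (b₂ - a₂) * N) by simp only [mul_assoc],
        trace_mul_comm, hN, mul_one, mul_assoc _ N, hN, mul_one]
    rw [← hU₂, ← hL₂, c1, c2, ← trace_sub, ← mul_sub, ← standardR_eq_sub,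
      ← neg_sub b a, ← neg_sub b₂ a₂, map_neg, neg_mul_neg]
  have w1 : P * b * P' * ((1 + p) * T₂) = (1 + p) * J * T₂ := by
    rw [← hg, hJ]
    calc P * b * P' * (P * N * T₂) = P * b * (P' * P) * N * T₂ := by simp only [mul_assoc]
      _ = P * (N * N') * b * N * T₂ := by rw [hP2, hN, mul_one, mul_one]
      _ = _ := by simp only [mul_assoc]
  have w2 : trace (P * b * P' * M₂) = trace (a₂ * b) := by
    rw [hM₂, show P * b * P' * (P * a₂ * P') = P * (b * (P' * P) * a₂ * P') by
      simp only [mul_assoc], trace_mul_comm, hP2, mul_one, mul_assoc _ P', hP2, mul_one,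
      trace_mul_comm]
  have w3 : trace (N' * a * N * (T₂ * (1 + p))) = trace (M * (1 + p) * T₂) := by
    rw [← hg, hM, show N' * a * N * (T₂ * (P * N)) = N' * (a * N * T₂ * P * N) by
      simp only [mul_assoc], trace_mul_comm, mul_assoc _ N, hN, mul_one, trace_mul_comm,
      show P * a * P' * (P * N) * T₂ = P * a * (P' * P) * N * T₂ by simp only [mul_assoc], hP2,
      mul_one]
    simp only [mul_assoc]
  have w4 : trace (N' * a * N * J₂) = trace (a * b₂) := by
    rw [hJ₂, show N' * a * N * (N' * b₂ * N) = N' * (a * (N * N') * b₂ * N) by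
      simp only [mul_assoc], trace_mul_comm, hN, mul_one, mul_assoc _ N, hN, mul_one]
  have hE' : trace ((a - b) * standardR n (a₂ - b₂)) =
      trace ((1 + p) * J * T₂) - trace (a₂ * b) - trace (M * ((1 + p) * T₂ - M₂))
        - trace (J * (J₂ - T₂ * (1 + p))) + trace (a * b₂) - trace (M * (1 + p) * T₂) := by
    rw [hE]
    have f1 : P * (b - a) * P' = P * b * P' - M := by rw [hM]; noncomm_ring
    have f2 : N' * (b - a) * N = J - N' * a * N := by rw [hJ]; noncomm_ring
    rw [f1, f2, sub_mul, sub_mul _ _ (J₂ - _), mul_sub (P * b * P'), mul_sub (N' * a * N)]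
    simp only [trace_sub, w1, w2, w3, w4]
    ring
  rw [hR, hE', hg]
  -- What is left is an identity between traces of words, up to cyclic rotation of the words.
  have cyc2 (x y : Matrix (Fin n) (Fin n) ℂ) : trace (x * y) = trace (y * x) := trace_mul_comm x y
  have cyc3 (x y z : Matrix (Fin n) (Fin n) ℂ) :
      trace (x * (y * z)) = trace (y * (z * x)) := by rw [trace_mul_comm, mul_assoc]
  have cyc4 (x y z t : Matrix (Fin n) (Fin n) ℂ) :
      trace (x * (y * (z * t))) = trace (y * (z * (t * x))) := by
    rw [trace_mul_comm, mul_assoc, mul_assoc]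
  simp only [mul_add, add_mul, mul_sub, sub_mul, mul_one, one_mul, mul_assoc, trace_add,
    trace_sub] at hUL ⊢
  linear_combination -hUL - cyc2 J M₂ - 2 * cyc2 T B₂ - cyc2 J A₂ + cyc2 J B₂ + cyc3 T p A₂ + cyc3 p A₂ T
    - cyc3 T p B₂ - cyc3 p T₂ B - cyc3 T₂ B p - cyc4 p T₂ T p - cyc4 T₂ T p p - cyc3 p B T₂
    + cyc3 p T₂ A + cyc3 T₂ A p + cyc4 p T₂ p T + cyc4 T₂ p T p + cyc4 p T p T₂
    + 2 * cyc2 T₂ A + 2 * cyc3 T₂ p T + 2 * cyc3 p T T₂ + cyc2 p Z₂ - cyc3 p J T₂ + cyc2 J₂ B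
    + cyc2 M₂ B

end Identity

/-! ### Splitting off the first pair -/

/-- The first pair (first column of `v`, first row of `wᵀ`) of a collection of pairs. -/
noncomputable def headPair (n d : ℕ) : SpinSpace n (d + 1) →L[ℂ] SpinSpace n 1 :=
  LinearMap.toContinuousLinearMap
    { toFun := fun y => (Matrix.of fun i _ => y.1 i 0, Matrix.of fun _ i => y.2 0 i)
      map_add' := fun _ _ => rfl
      map_smul' := fun _ _ => rfl }

/-- The collection of all pairs but the first one. -/
noncomputable def tailPairs (n d : ℕ) : SpinSpace n (d + 1) →L[ℂ] SpinSpace n d :=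
  LinearMap.toContinuousLinearMap
    { toFun := fun y => (Matrix.of fun i k => y.1 i k.succ, Matrix.of fun k i => y.2 k.succ i)
      map_add' := fun _ _ => rfl
      map_smul' := fun _ _ => rfl }

/-- Prepend a pair to a collection of pairs. -/
noncomputable def consPairs (n d : ℕ) : SpinSpace n 1 × SpinSpace n d →L[ℂ] SpinSpace n (d + 1) :=
  LinearMap.toContinuousLinearMap
    { toFun := fun z =>
        (Matrix.of fun i => Fin.cons (z.1.1 i 0) (z.2.1 i),
          Matrix.of fun k i => (Fin.cons (z.1.2 0 i) fun j => z.2.2 j i : Fin (d + 1) → ℂ) k)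
      map_add' := fun z z' => by
        refine Prod.ext ?_ ?_
        · ext i k; refine Fin.cases ?_ (fun k => ?_) k <;> simp
        · ext k i; refine Fin.cases ?_ (fun k => ?_) k <;> simp
      map_smul' := fun c z => by
        refine Prod.ext ?_ ?_
        · ext i k; refine Fin.cases ?_ (fun k => ?_) k <;> simp
        · ext k i; refine Fin.cases ?_ (fun k => ?_) k <;> simp }

section Pairs

variable {n d : ℕ}

@[simp] theorem headPair_fst (y : SpinSpace n (d + 1)) (i : Fin n) (k : Fin 1) :
    (headPair n d y).1 i k = y.1 i 0 := rfl

@[simp] theorem headPair_snd (y : SpinSpace n (d + 1)) (i : Fin n) (k : Fin 1) :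
    (headPair n d y).2 k i = y.2 0 i := rfl

@[simp] theorem tailPairs_fst (y : SpinSpace n (d + 1)) (i : Fin n) (k : Fin d) :
    (tailPairs n d y).1 i k = y.1 i k.succ := rfl

@[simp] theorem tailPairs_snd (y : SpinSpace n (d + 1)) (i : Fin n) (k : Fin d) :
    (tailPairs n d y).2 k i = y.2 k.succ i := rfl

@[simp] theorem headPair_consPairs (z : SpinSpace n 1 × SpinSpace n d) :
    headPair n d (consPairs n d z) = z.1 := by
  refine Prod.ext ?_ ?_
  · ext i k; rw [Subsingleton.elim k 0]; rfl
  · ext k i; rw [Subsingleton.elim k 0]; rfl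

@[simp] theorem tailPairs_consPairs (z : SpinSpace n 1 × SpinSpace n d) :
    tailPairs n d (consPairs n d z) = z.2 := rfl

theorem consPairs_head_tail (y : SpinSpace n (d + 1)) :
    consPairs n d (headPair n d y, tailPairs n d y) = y := by
  refine Prod.ext ?_ ?_
  · ext i k; refine Fin.cases ?_ (fun k => ?_) k <;> rfl
  · ext k i; refine Fin.cases ?_ (fun k => ?_) k <;> rfl

end Pairs

/-! ### Differentials as matrices -/

/-- The trace pairing between covectors `(ξ, xᵀ)` and vectors `(v̇, ẇᵀ)`. -/
noncomputable def spinPairing {n d : ℕ} (c z : SpinSpace n d) : ℂ :=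
  trace (c.2 * z.1) + trace (z.2 * c.1)

/-- The differential of a function in the form `(ξ, xᵀ)`. -/
noncomputable def spinGrad {n d : ℕ} (F : SpinSpace n d → ℂ) (m : SpinSpace n d) : SpinSpace n d :=
  (deltaW F m, deltaV F m)

section Gradient

variable {n d : ℕ}

theorem spinPairing_single_fst (c : SpinSpace n d) (i : Fin n) (k : Fin d) :
    spinPairing c (Matrix.single i k 1, 0) = c.2 k i := by
  simp [spinPairing, trace_mul_single]

theorem spinPairing_single_snd (c : SpinSpace n d) (i : Fin n) (k : Fin d) :
    spinPairing c (0, Matrix.single k i 1) = c.1 i k := by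
  simp [spinPairing, trace_single_mul]

theorem spinGrad_eq {F : SpinSpace n d → ℂ} {m c : SpinSpace n d}
    (h : ∀ z, fderiv ℂ F m z = spinPairing c z) : spinGrad F m = c := by
  refine Prod.ext ?_ ?_
  · ext i k; simp [spinGrad, deltaW, h, spinPairing_single_snd]
  · ext k i; simp [spinGrad, deltaV, h, spinPairing_single_fst]

theorem fderiv_eq_spinPairing (F : SpinSpace n d → ℂ) (m z : SpinSpace n d) :
    fderiv ℂ F m z = spinPairing (spinGrad F m) z := by
  have h1 : fderiv ℂ F m (z.1, 0) = trace (deltaV F m * z.1) := by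
    have : (z.1, (0 : Matrix (Fin d) (Fin n) ℂ)) =
        ∑ i, ∑ k, z.1 i k • ((Matrix.single i k 1, 0) : SpinSpace n d) := by
      refine Prod.ext ?_ ?_
      · simp only [Prod.fst_sum, Prod.smul_fst, smul_single, smul_eq_mul, mul_one]
        exact matrix_eq_sum_single z.1
      · simp [Prod.snd_sum]
    rw [this, trace_mul_comm, trace_mul_eq_sum]
    simp only [map_sum, map_smul, smul_eq_mul, deltaV, of_apply]
  have h2 : fderiv ℂ F m (0, z.2) = trace (z.2 * deltaW F m) := by
    have : ((0 : Matrix (Fin n) (Fin d) ℂ), z.2) =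
        ∑ k, ∑ i, z.2 k i • ((0, Matrix.single k i 1) : SpinSpace n d) := by
      refine Prod.ext ?_ ?_
      · simp [Prod.fst_sum]
      · simp only [Prod.snd_sum, Prod.smul_snd, smul_single, smul_eq_mul, mul_one]
        exact matrix_eq_sum_single z.2
    rw [this, trace_mul_eq_sum]
    simp only [map_sum, map_smul, smul_eq_mul, deltaW, of_apply]
  have : z = (z.1, 0) + (0, z.2) := by simp
  rw [this, map_add, h1, h2]
  simp [spinPairing, spinGrad]

theorem spinPairing_consPairs (c : SpinSpace n (d + 1)) (z : SpinSpace n 1 × SpinSpace n d) :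
    spinPairing c (consPairs n d z) =
      spinPairing (headPair n d c) z.1 + spinPairing (tailPairs n d c) z.2 := by
  obtain ⟨z, rfl⟩ : ∃ y, (headPair n d y, tailPairs n d y) = z :=
    ⟨consPairs n d z, by simp⟩
  rw [consPairs_head_tail]
  simp only [spinPairing, trace_mul_eq_sum, Fin.sum_univ_succ, Fin.sum_univ_zero,
    headPair_fst, headPair_snd, tailPairs_fst, tailPairs_snd]
  ring

end Gradient

/-! ### The bivector in terms of `n × n` traces -/

section Form

variable {n d : ℕ}

/-- Twice the bivector at parameter `1`, with all terms but that of `ρ` written as traces of `n × n`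
matrices. -/
theorem zakForm_eq_trace (R : Matrix (Fin n) (Fin n) ℂ →ₗ[ℂ] Matrix (Fin n) (Fin n) ℂ)
    (ρ : Matrix (Fin d) (Fin d) ℂ →ₗ[ℂ] Matrix (Fin d) (Fin d) ℂ)
    (v : Matrix (Fin n) (Fin d) ℂ) (w : Matrix (Fin d) (Fin n) ℂ)
    (x : Matrix (Fin d) (Fin n) ℂ) (ξ : Matrix (Fin n) (Fin d) ℂ)
    (y : Matrix (Fin d) (Fin n) ℂ) (η : Matrix (Fin n) (Fin d) ℂ) :
    2 * zakForm R ρ 1 v w x ξ y η =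
      -trace ((v * x - ξ * w) * R (v * y - η * w)) - trace ((x * v - w * ξ) * ρ (y * v - w * η))
        - trace (v * y * (ξ * w)) + trace (v * x * (η * w)) - trace (v * w * (ξ * y - η * x))
        + 2 * trace (η * x - ξ * y) := by
  have h1 : trace (w * v * (y * ξ)) = trace (v * y * (ξ * w)) := by
    rw [Matrix.mul_assoc w, trace_mul_comm]; simp only [Matrix.mul_assoc]
  have h2 : trace (w * v * (x * η)) = trace (v * x * (η * w)) := by
    rw [Matrix.mul_assoc w, trace_mul_comm]; simp only [Matrix.mul_assoc]
  rw [zakForm, Matrix.mul_sub (w * v), trace_sub (w * v * (y * ξ)), h1, h2, trace_sub (x * η),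
    trace_mul_comm x η, trace_mul_comm y ξ, trace_sub (η * x)]
  ring

theorem standardR_one (A : Matrix (Fin 1) (Fin 1) ℂ) : standardR 1 A = 0 := by
  ext i j
  simp [standardR_apply, Subsingleton.elim i j]

theorem mul_eq_head_add_tail (y z : SpinSpace n (d + 1)) :
    y.1 * z.2 = (headPair n d y).1 * (headPair n d z).2 +
      (tailPairs n d y).1 * (tailPairs n d z).2 := by
  ext i j
  simp [Matrix.mul_apply, Fin.sum_univ_succ]

/-- The r-matrix form of size `d + 1`, split along the first index. -/
theorem trace_mul_standardR_succ (A B : Matrix (Fin (d + 1)) (Fin (d + 1)) ℂ) :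
    trace (A * standardR (d + 1) B) =
      trace (A.submatrix Fin.succ Fin.succ * standardR d (B.submatrix Fin.succ Fin.succ))
        + ∑ k : Fin d, A k.succ 0 * B 0 k.succ - ∑ k : Fin d, A 0 k.succ * B k.succ 0 := by
  simp only [trace_mul_eq_sum, Fin.sum_univ_succ, standardR_apply, Fin.succ_lt_succ_iff,
    Fin.succ_pos, Fin.not_lt_zero, lt_self_iff_false, if_true, if_false, submatrix_apply,
    Finset.sum_add_distrib, mul_neg, Finset.sum_neg_distrib, mul_zero]
  ring

/-- The `R_{d+1}` term of the bracket, split along the first pair. -/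
theorem trace_standardR_succ_pairs (z c e : SpinSpace n (d + 1)) :
    trace ((c.2 * z.1 - z.2 * c.1) * standardR (d + 1) (e.2 * z.1 - z.2 * e.1)) =
      trace (((tailPairs n d c).2 * (tailPairs n d z).1 - (tailPairs n d z).2 * (tailPairs n d c).1)
          * standardR d ((tailPairs n d e).2 * (tailPairs n d z).1
              - (tailPairs n d z).2 * (tailPairs n d e).1))
        + trace (((tailPairs n d c).2 * (headPair n d z).1
              - (tailPairs n d z).2 * (headPair n d c).1)
            * ((headPair n d e).2 * (tailPairs n d z).1
              - (headPair n d z).2 * (tailPairs n d e).1))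
        - trace (((headPair n d c).2 * (tailPairs n d z).1
              - (headPair n d z).2 * (tailPairs n d c).1)
            * ((tailPairs n d e).2 * (headPair n d z).1
              - (tailPairs n d z).2 * (headPair n d e).1)) := by
  rw [trace_mul_standardR_succ, trace_mul_eq_sum (_ - _) ((headPair n d e).2 * _ - _),
    trace_mul_eq_sum (_ - _) ((tailPairs n d e).2 * _ - _)]
  simp only [Fin.sum_univ_succ, Fin.sum_univ_zero, add_zero]
  rfl

end Form

/-! ### The triangular factors and their derivatives -/

namespace FactorizationBranch

variable {n : ℕ} (B : FactorizationBranch n) {m : SpinSpace n 1}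

theorem plus_isUpperTriangular (hm : m ∈ B.domain) : (B.plus m).IsUpperTriangular :=
  fun i j h => B.plus_upper m hm i j h

theorem minus_isLowerTriangular (hm : m ∈ B.domain) : (B.minus m).IsLowerTriangular :=
  fun i j h => B.minus_lower m hm i j h

theorem plus_diag_ne_zero (hm : m ∈ B.domain) (i : Fin n) : B.plus m i i ≠ 0 :=
  left_ne_zero_of_mul_eq_one (B.diag_mul m hm i)

theorem minus_diag_ne_zero (hm : m ∈ B.domain) (i : Fin n) : B.minus m i i ≠ 0 :=
  right_ne_zero_of_mul_eq_one (B.diag_mul m hm i)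

theorem det_plus_ne_zero (hm : m ∈ B.domain) : (B.plus m).det ≠ 0 := by
  rw [det_of_isUpperTriangular (B.plus_isUpperTriangular hm)]
  exact Finset.prod_ne_zero_iff.2 fun i _ => B.plus_diag_ne_zero hm i

theorem det_minus_ne_zero (hm : m ∈ B.domain) : (B.minus m).det ≠ 0 := by
  rw [det_of_isLowerTriangular _ (B.minus_isLowerTriangular hm)]
  exact Finset.prod_ne_zero_iff.2 fun i _ => B.minus_diag_ne_zero hm i

theorem plus_mul_inv (hm : m ∈ B.domain) : B.plus m * (B.plus m)⁻¹ = 1 :=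
  mul_nonsing_inv _ (B.det_plus_ne_zero hm).isUnit

theorem inv_mul_plus (hm : m ∈ B.domain) : (B.plus m)⁻¹ * B.plus m = 1 :=
  nonsing_inv_mul _ (B.det_plus_ne_zero hm).isUnit

theorem minus_mul_inv (hm : m ∈ B.domain) : B.minus m * (B.minus m)⁻¹ = 1 :=
  mul_nonsing_inv _ (B.det_minus_ne_zero hm).isUnit

theorem inv_mul_minus (hm : m ∈ B.domain) : (B.minus m)⁻¹ * B.minus m = 1 :=
  nonsing_inv_mul _ (B.det_minus_ne_zero hm).isUnit

theorem inv_plus_isUpperTriangular (hm : m ∈ B.domain) : (B.plus m)⁻¹.IsUpperTriangular := by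
  have := invertibleOfRightInverse _ _ (B.plus_mul_inv hm)
  exact blockTriangular_inv_of_blockTriangular (B.plus_isUpperTriangular hm)

theorem inv_minus_isLowerTriangular (hm : m ∈ B.domain) : (B.minus m)⁻¹.IsLowerTriangular := by
  have := invertibleOfRightInverse _ _ (B.minus_mul_inv hm)
  exact blockTriangular_inv_of_blockTriangular (B.minus_isLowerTriangular hm)

theorem inv_plus_diag (hm : m ∈ B.domain) (i : Fin n) : (B.plus m)⁻¹ i i = B.minus m i i := by
  refine mul_left_cancel₀ (B.plus_diag_ne_zero hm i) ?_
  rw [← (B.plus_isUpperTriangular hm).mul_diag (B.inv_plus_isUpperTriangular hm),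
    B.plus_mul_inv hm, B.diag_mul m hm, one_apply_eq]

theorem inv_minus_diag (hm : m ∈ B.domain) (i : Fin n) : (B.minus m)⁻¹ i i = B.plus m i i := by
  refine mul_left_cancel₀ (B.minus_diag_ne_zero hm i) ?_
  rw [← (B.minus_isLowerTriangular hm).mul_diag (B.inv_minus_isLowerTriangular hm),
    B.minus_mul_inv hm, mul_comm, B.diag_mul m hm, one_apply_eq]

theorem differentiableAt_plus (hm : m ∈ B.domain) : DifferentiableAt ℂ B.plus m :=
  B.holo_plus.differentiableAt (B.isOpen_domain.mem_nhds hm)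

theorem differentiableAt_minus (hm : m ∈ B.domain) : DifferentiableAt ℂ B.minus m :=
  B.holo_minus.differentiableAt (B.isOpen_domain.mem_nhds hm)

theorem differentiableAt_inv_plus (hm : m ∈ B.domain) :
    DifferentiableAt ℂ (fun y => (B.plus y)⁻¹) m :=
  (B.differentiableAt_plus hm).matrix_inv (B.det_plus_ne_zero hm)

theorem differentiableAt_inv_minus (hm : m ∈ B.domain) :
    DifferentiableAt ℂ (fun y => (B.minus y)⁻¹) m :=
  (B.differentiableAt_minus hm).matrix_inv (B.det_minus_ne_zero hm)

theorem fderiv_plus_isUpperTriangular (hm : m ∈ B.domain) (h : SpinSpace n 1) :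
    (fderiv ℂ B.plus m h).IsUpperTriangular := fun i j hij => by
  have : (fun y => B.plus y i j) =ᶠ[nhds m] fun _ => 0 := by
    filter_upwards [B.isOpen_domain.mem_nhds hm] with y hy using B.plus_upper y hy i j hij
  refine (fderiv_matrix_apply (B.differentiableAt_plus hm) h i j).trans ?_
  exact (this.fderiv_apply_eq h).trans (fderiv_const_fun_apply 0 m h)

theorem fderiv_inv_minus_isLowerTriangular (hm : m ∈ B.domain) (h : SpinSpace n 1) :
    (fderiv ℂ (fun y => (B.minus y)⁻¹) m h).IsLowerTriangular := fun i j hij => by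
  have : (fun y => (B.minus y)⁻¹ i j) =ᶠ[nhds m] fun _ => 0 := by
    filter_upwards [B.isOpen_domain.mem_nhds hm] with y hy
      using B.inv_minus_isLowerTriangular hy hij
  refine (fderiv_matrix_apply (B.differentiableAt_inv_minus hm) h i j).trans ?_
  exact (this.fderiv_apply_eq h).trans (fderiv_const_fun_apply 0 m h)

theorem fderiv_plus_diag (hm : m ∈ B.domain) (h : SpinSpace n 1) (i : Fin n) :
    fderiv ℂ B.plus m h i i = fderiv ℂ (fun y => (B.minus y)⁻¹) m h i i := by
  have : (fun y => (B.minus y)⁻¹ i i) =ᶠ[nhds m] fun y => B.plus y i i := by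
    filter_upwards [B.isOpen_domain.mem_nhds hm] with y hy using B.inv_minus_diag hy i
  exact (fderiv_matrix_apply (B.differentiableAt_plus hm) h i i).trans
    ((this.fderiv_apply_eq h).symm.trans
      (fderiv_matrix_apply (B.differentiableAt_inv_minus hm) h i i).symm)

/-- The differentiated factorization `d(Φ₊ Φ₋⁻¹) = d(v wᵀ)`. -/
theorem fderiv_factor (hm : m ∈ B.domain) (h : SpinSpace n 1) :
    B.plus m * fderiv ℂ (fun y => (B.minus y)⁻¹) m h + fderiv ℂ B.plus m h * (B.minus m)⁻¹ =
      m.1 * h.2 + h.1 * m.2 := by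
  have : (fun y => B.plus y * (B.minus y)⁻¹) =ᶠ[nhds m] fun y => 1 + y.1 * y.2 := by
    filter_upwards [B.isOpen_domain.mem_nhds hm] with y hy using B.factor y hy
  refine (fderiv_matrix_mul (B.differentiableAt_plus hm) (B.differentiableAt_inv_minus hm)
    h).symm.trans ?_
  refine (this.fderiv_apply_eq h).trans ((DFunLike.congr_fun (fderiv_const_add _) h).trans ?_)
  refine (fderiv_matrix_mul differentiableAt_fst differentiableAt_snd h).trans ?_
  exact congrArg₂ (fun a b => m.1 * a + b * m.2)
    (DFunLike.congr_fun fderiv_snd h) (DFunLike.congr_fun fderiv_fst h)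

/-- The pullback to `(v, wᵀ)` of covectors attached to the two triangular factors. The logarithmic
derivatives `α = P⁻¹ dP` and `β = dN N⁻¹` are recovered from their sum as its upper and lower halves,
and these projections are moved to `a` and `b` by adjunction. -/
theorem trace_fderiv_factors (hm : m ∈ B.domain) (a b : Matrix (Fin n) (Fin n) ℂ)
    (h : SpinSpace n 1) :
    trace (a * ((B.plus m)⁻¹ * fderiv ℂ B.plus m h))
      + trace (b * (fderiv ℂ (fun y => (B.minus y)⁻¹) m h * B.minus m)) =
    spinPairing (dressShift (B.plus m)⁻¹ (B.minus m) a b * m.1,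
      m.2 * dressShift (B.plus m)⁻¹ (B.minus m) a b) h := by
  set α := (B.plus m)⁻¹ * fderiv ℂ B.plus m h with hα
  set β := fderiv ℂ (fun y => (B.minus y)⁻¹) m h * B.minus m with hβ
  have hu : α.IsUpperTriangular :=
    (B.inv_plus_isUpperTriangular hm).mul (B.fderiv_plus_isUpperTriangular hm h)
  have hl : β.IsLowerTriangular :=
    (B.fderiv_inv_minus_isLowerTriangular hm h).mul (B.minus_isLowerTriangular hm)
  have hd (i) : α i i = β i i := by
    rw [hα, hβ, (B.inv_plus_isUpperTriangular hm).mul_diag (B.fderiv_plus_isUpperTriangular hm h),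
      (B.fderiv_inv_minus_isLowerTriangular hm h).mul_diag (B.minus_isLowerTriangular hm),
      B.inv_plus_diag hm, B.fderiv_plus_diag hm, mul_comm]
  have hsum : α + β = (B.plus m)⁻¹ * (m.1 * h.2 + h.1 * m.2) * B.minus m := by
    rw [← B.fderiv_factor hm, mul_add, add_mul, ← mul_assoc _ (B.plus m), B.inv_mul_plus hm,
      one_mul, mul_assoc _ _ (B.minus m), mul_assoc _ _ (B.minus m), B.inv_mul_minus hm, mul_one,
      add_comm]
  have h1 : trace (a * α) = trace (lowerHalf a * (α + β)) := by
    rw [← trace_mul_upperHalf, upperHalf_upper_add_lower hu hl hd]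
  have h2 : trace (b * β) = trace (upperHalf b * (α + β)) := by
    rw [← trace_mul_lowerHalf, lowerHalf_upper_add_lower hu hl hd]
  rw [h1, h2, ← trace_add, ← add_mul, hsum, ← mul_assoc, trace_mul_comm, ← mul_assoc, ← mul_assoc,
    ← dressShift, Matrix.mul_add, trace_add, spinPairing, add_comm]
  congr 1
  · rw [← Matrix.mul_assoc, trace_mul_comm, Matrix.mul_assoc]
  · rw [← Matrix.mul_assoc, trace_mul_comm]

end FactorizationBranch

/-! ### Half-dressing of several pairs by one pair -/

/-- The half-dressing of a whole collection of pairs by one pair. -/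
noncomputable def dressPairs {n d : ℕ} (B : FactorizationBranch n) (m : SpinSpace n 1)
    (M : SpinSpace n d) : SpinSpace n d :=
  (B.plus m * M.1, M.2 * (B.minus m)⁻¹)

/-- The inverse of `dressPairs B m`, for `m` in the domain of the branch. -/
noncomputable def undressPairs {n d : ℕ} (B : FactorizationBranch n) (m : SpinSpace n 1)
    (M : SpinSpace n d) : SpinSpace n d :=
  ((B.plus m)⁻¹ * M.1, M.2 * B.minus m)

section Dressing

variable {n d : ℕ} (B : FactorizationBranch n) {m : SpinSpace n 1}

theorem undressPairs_dressPairs (hm : m ∈ B.domain) (M : SpinSpace n d) :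
    undressPairs B m (dressPairs B m M) = M := by
  refine Prod.ext ?_ ?_
  · simp only [undressPairs, dressPairs, ← Matrix.mul_assoc, B.inv_mul_plus hm, Matrix.one_mul]
  · simp only [undressPairs, dressPairs, Matrix.mul_assoc, B.inv_mul_minus hm, Matrix.mul_one]

theorem dressPairs_undressPairs (hm : m ∈ B.domain) (M : SpinSpace n d) :
    dressPairs B m (undressPairs B m M) = M := by
  refine Prod.ext ?_ ?_
  · simp only [undressPairs, dressPairs, ← Matrix.mul_assoc, B.plus_mul_inv hm, Matrix.one_mul]
  · simp only [undressPairs, dressPairs, Matrix.mul_assoc, B.minus_mul_inv hm, Matrix.mul_one]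

/-- Half-dressing is jointly holomorphic in the dressing pair and the dressed pairs. -/
theorem DifferentiableAt.dressPairs {E : Type*} [NormedAddCommGroup E] [NormedSpace ℂ E]
    {f : E → SpinSpace n 1} {g : E → SpinSpace n d} {x : E} (hf : DifferentiableAt ℂ f x)
    (hg : DifferentiableAt ℂ g x) (hx : f x ∈ B.domain) :
    DifferentiableAt ℂ (fun y => dressPairs B (f y) (g y)) x :=
  (((B.differentiableAt_plus hx).comp x hf).matrix_mul hg.fst).prodMk
    (hg.snd.matrix_mul ((B.differentiableAt_inv_minus hx).comp x hf))

theorem DifferentiableAt.undressPairs {E : Type*} [NormedAddCommGroup E] [NormedSpace ℂ E]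
    {f : E → SpinSpace n 1} {g : E → SpinSpace n d} {x : E} (hf : DifferentiableAt ℂ f x)
    (hg : DifferentiableAt ℂ g x) (hx : f x ∈ B.domain) :
    DifferentiableAt ℂ (fun y => undressPairs B (f y) (g y)) x :=
  (((B.differentiableAt_inv_plus hx).comp x hf).matrix_mul hg.fst).prodMk
    (hg.snd.matrix_mul ((B.differentiableAt_minus hx).comp x hf))

theorem fderiv_dressPairs_left (hm : m ∈ B.domain) (M : SpinSpace n d) (h : SpinSpace n 1) :
    fderiv ℂ (fun m => dressPairs B m M) m h =
      (fderiv ℂ B.plus m h * M.1, M.2 * fderiv ℂ (fun y => (B.minus y)⁻¹) m h) := by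
  have h1 : DifferentiableAt ℂ (fun m => B.plus m * M.1) m :=
    (B.differentiableAt_plus hm).matrix_mul (differentiableAt_const _)
  have h2 : DifferentiableAt ℂ (fun m => M.2 * (B.minus m)⁻¹) m :=
    (differentiableAt_const _).matrix_mul (B.differentiableAt_inv_minus hm)
  exact (fderiv_prodMk_apply h1 h2 h).trans
    (Prod.ext (fderiv_matrix_mul_const _ (B.differentiableAt_plus hm) h)
      (fderiv_const_matrix_mul _ (B.differentiableAt_inv_minus hm) h))

theorem differentiableAt_dressPairs_right (m : SpinSpace n 1) (M : SpinSpace n d) :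
    DifferentiableAt ℂ (dressPairs B m) M :=
  DifferentiableAt.prodMk ((differentiableAt_const _).matrix_mul differentiableAt_fst)
    (differentiableAt_snd.matrix_mul (differentiableAt_const _))

theorem fderiv_dressPairs_right (m : SpinSpace n 1) (M h : SpinSpace n d) :
    fderiv ℂ (dressPairs B m) M h = dressPairs B m h := by
  have h1 : DifferentiableAt ℂ (fun M : SpinSpace n d => B.plus m * M.1) M :=
    (differentiableAt_const _).matrix_mul differentiableAt_fst
  have h2 : DifferentiableAt ℂ (fun M : SpinSpace n d => M.2 * (B.minus m)⁻¹) M :=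
    differentiableAt_snd.matrix_mul (differentiableAt_const _)
  refine (fderiv_prodMk_apply h1 h2 h).trans (Prod.ext ?_ ?_)
  · exact (fderiv_const_matrix_mul _ differentiableAt_fst h).trans
      (congrArg (B.plus m * ·) (DFunLike.congr_fun fderiv_fst h))
  · exact (fderiv_matrix_mul_const _ differentiableAt_snd h).trans
      (congrArg (· * (B.minus m)⁻¹) (DFunLike.congr_fun fderiv_snd h))

variable {F : SpinSpace n (d + 1) → ℂ} {M : SpinSpace n d}

/-- The pullback of a covector to the dressed pairs. -/
theorem spinGrad_comp_dressPairs_right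
    (hF : DifferentiableAt ℂ F (consPairs n d (m, dressPairs B m M))) :
    spinGrad (fun M => F (consPairs n d (m, dressPairs B m M))) M =
      ((B.minus m)⁻¹ * (tailPairs n d (spinGrad F (consPairs n d (m, dressPairs B m M)))).1,
        (tailPairs n d (spinGrad F (consPairs n d (m, dressPairs B m M)))).2 * B.plus m) := by
  refine spinGrad_eq fun h => ?_
  have h1 := differentiableAt_dressPairs_right B m M
  have h2 : fderiv ℂ (fun M => (m, dressPairs B m M)) M h = (0, dressPairs B m h) :=
    (fderiv_prodMk_apply (differentiableAt_const m) h1 h).trans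
      (Prod.ext (fderiv_const_fun_apply m M h) (fderiv_dressPairs_right B m M h))
  refine (fderiv_comp_clm_apply (L := consPairs n d) (f := fun M => (m, dressPairs B m M)) hF
    ((differentiableAt_const m).prodMk h1) h).trans ?_
  refine (congrArg (fun z => fderiv ℂ F _ (consPairs n d z)) h2).trans ?_
  refine (fderiv_eq_spinPairing F _ _).trans ((spinPairing_consPairs _ _).trans ?_)
  simp only [spinPairing, dressPairs, Matrix.mul_assoc, Prod.fst_zero, Prod.snd_zero,
    Matrix.mul_zero, Matrix.zero_mul, trace_zero, add_zero, zero_add]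
  rfl

/-- The pullback of a covector to the dressing pair. -/
theorem spinGrad_comp_dressPairs_left (hm : m ∈ B.domain)
    (hF : DifferentiableAt ℂ F (consPairs n d (m, dressPairs B m M)))
    {c : SpinSpace n (d + 1)} (hc : c = spinGrad F (consPairs n d (m, dressPairs B m M)))
    {T : Matrix (Fin n) (Fin n) ℂ}
    (hT : T = dressShift (B.plus m)⁻¹ (B.minus m) (M.1 * (tailPairs n d c).2 * B.plus m)
      ((B.minus m)⁻¹ * (tailPairs n d c).1 * M.2)) :
    spinGrad (fun m => F (consPairs n d (m, dressPairs B m M))) m =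
      ((headPair n d c).1 + T * m.1, (headPair n d c).2 + m.2 * T) := by
  refine spinGrad_eq fun h => ?_
  have h0 : DifferentiableAt ℂ (fun m => dressPairs B m M) m :=
    DifferentiableAt.dressPairs B differentiableAt_fun_id (differentiableAt_const M) hm
  have h2 : fderiv ℂ (fun m => (m, dressPairs B m M)) m h =
      (h, (fderiv ℂ B.plus m h * M.1, M.2 * fderiv ℂ (fun y => (B.minus y)⁻¹) m h)) :=
    (fderiv_prodMk_apply differentiableAt_fun_id h0 h).trans
      (Prod.ext (DFunLike.congr_fun fderiv_fun_id h) (fderiv_dressPairs_left B hm M h))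
  have h3 := B.trace_fderiv_factors hm (M.1 * (tailPairs n d c).2 * B.plus m)
    ((B.minus m)⁻¹ * (tailPairs n d c).1 * M.2) h
  rw [← hT] at h3
  refine (fderiv_comp_clm_apply (L := consPairs n d) (f := fun m => (m, dressPairs B m M)) hF
    (differentiableAt_fun_id.prodMk h0) h).trans ?_
  refine (congrArg (fun z => fderiv ℂ F _ (consPairs n d z)) h2).trans ?_
  refine (hc ▸ fderiv_eq_spinPairing F _ _ : _ = spinPairing c _).trans ?_
  rw [spinPairing_consPairs]
  have h4 : trace (M.1 * (tailPairs n d c).2 * B.plus m *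
      ((B.plus m)⁻¹ * fderiv ℂ B.plus m h)) =
      trace ((tailPairs n d c).2 * (fderiv ℂ B.plus m h * M.1)) := by
    rw [Matrix.mul_assoc (M.1 * _), ← Matrix.mul_assoc (B.plus m), B.plus_mul_inv hm,
      Matrix.one_mul, Matrix.mul_assoc, trace_mul_comm, Matrix.mul_assoc]
  have h5 : trace ((B.minus m)⁻¹ * (tailPairs n d c).1 * M.2 *
      (fderiv ℂ (fun y => (B.minus y)⁻¹) m h * B.minus m)) =
      trace (M.2 * fderiv ℂ (fun y => (B.minus y)⁻¹) m h * (tailPairs n d c).1) := by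
    rw [trace_mul_comm, Matrix.mul_assoc, Matrix.mul_assoc, ← Matrix.mul_assoc (B.minus m),
      B.minus_mul_inv hm, Matrix.one_mul, ← Matrix.mul_assoc, trace_mul_comm, ← Matrix.mul_assoc]
  rw [h4, h5] at h3
  simp only [spinPairing, Matrix.add_mul, Matrix.mul_add, trace_add]
    at h3 ⊢
  linear_combination h3

end Dressing

/-! ### Half-dressing by one pair is a Poisson map -/

theorem zakBracket_eq_spinGrad {n d : ℕ} (F H : SpinSpace n d → ℂ) (m : SpinSpace n d) :
    zakBracket (standardR n) (standardR d) 1 F H m =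
      zakForm (standardR n) (standardR d) 1 m.1 m.2 (spinGrad F m).2 (spinGrad F m).1
        (spinGrad H m).2 (spinGrad H m).1 := rfl

/-- The bivector of `d + 1` pairs, split along the first pair. -/
theorem two_mul_zakForm_succ {n d : ℕ} (z c e : SpinSpace n (d + 1)) {m : SpinSpace n 1}
    {Y : SpinSpace n d} {c₀ e₀ : SpinSpace n 1} {c₁ e₁ : SpinSpace n d}
    (hm : headPair n d z = m) (hY : tailPairs n d z = Y)
    (hc₀ : headPair n d c = c₀) (hc₁ : tailPairs n d c = c₁)
    (he₀ : headPair n d e = e₀) (he₁ : tailPairs n d e = e₁) :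
    2 * zakForm (standardR n) (standardR (d + 1)) 1 z.1 z.2 c.2 c.1 e.2 e.1 =
      -trace ((m.1 * c₀.2 + Y.1 * c₁.2 - (c₀.1 * m.2 + c₁.1 * Y.2)) *
          standardR n (m.1 * e₀.2 + Y.1 * e₁.2 - (e₀.1 * m.2 + e₁.1 * Y.2)))
      - trace ((c₁.2 * Y.1 - Y.2 * c₁.1) * standardR d (e₁.2 * Y.1 - Y.2 * e₁.1))
      - (trace (Y.1 * c₁.2 * (m.1 * e₀.2)) - trace (e₁.1 * c₁.2 * (m.1 * m.2))
          - trace (Y.1 * Y.2 * (c₀.1 * e₀.2)) + trace (e₁.1 * Y.2 * (c₀.1 * m.2)))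
      + (trace (m.1 * c₀.2 * (Y.1 * e₁.2)) - trace (Y.1 * Y.2 * (e₀.1 * c₀.2))
          - trace (m.1 * m.2 * (c₁.1 * e₁.2)) + trace (e₀.1 * m.2 * (c₁.1 * Y.2)))
      - trace ((m.1 * e₀.2 + Y.1 * e₁.2) * (c₀.1 * m.2 + c₁.1 * Y.2))
      + trace ((m.1 * c₀.2 + Y.1 * c₁.2) * (e₀.1 * m.2 + e₁.1 * Y.2))
      - trace ((m.1 * m.2 + Y.1 * Y.2) *
          (c₀.1 * e₀.2 + c₁.1 * e₁.2 - (e₀.1 * c₀.2 + e₁.1 * c₁.2)))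
      + 2 * trace (e₀.1 * c₀.2 + e₁.1 * c₁.2 - (c₀.1 * e₀.2 + c₁.1 * e₁.2)) := by
  rw [zakForm_eq_trace, trace_standardR_succ_pairs]
  simp only [mul_eq_head_add_tail z c, mul_eq_head_add_tail c z, mul_eq_head_add_tail z e,
    mul_eq_head_add_tail e z, mul_eq_head_add_tail z z, mul_eq_head_add_tail c e,
    mul_eq_head_add_tail e c, hm, hY, hc₀, hc₁, he₀, he₁]
  have rot {k l : ℕ} (a : Matrix (Fin k) (Fin n) ℂ) (b : Matrix (Fin n) (Fin l) ℂ)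
      (f : Matrix (Fin l) (Fin n) ℂ) (g : Matrix (Fin n) (Fin k) ℂ) :
      trace (a * b * (f * g)) = trace (g * a * (b * f)) := by
    rw [← Matrix.mul_assoc, trace_mul_comm]; simp only [Matrix.mul_assoc]
  have rot' {k l : ℕ} (a : Matrix (Fin k) (Fin n) ℂ) (b : Matrix (Fin n) (Fin l) ℂ)
      (f : Matrix (Fin l) (Fin n) ℂ) (g : Matrix (Fin n) (Fin k) ℂ) :
      trace (a * b * (f * g)) = trace (b * f * (g * a)) := by
    rw [Matrix.mul_assoc, trace_mul_comm]; simp only [Matrix.mul_assoc]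
  have h1 : trace ((c₁.2 * m.1 - Y.2 * c₀.1) * (e₀.2 * Y.1 - m.2 * e₁.1)) =
      trace (Y.1 * c₁.2 * (m.1 * e₀.2)) - trace (e₁.1 * c₁.2 * (m.1 * m.2))
          - trace (Y.1 * Y.2 * (c₀.1 * e₀.2)) + trace (e₁.1 * Y.2 * (c₀.1 * m.2)) := by
    simp only [Matrix.mul_sub, Matrix.sub_mul, trace_sub, rot]
    ring
  have h2 : trace ((c₀.2 * Y.1 - m.2 * c₁.1) * (e₁.2 * m.1 - Y.2 * e₀.1)) =
      trace (m.1 * c₀.2 * (Y.1 * e₁.2)) - trace (Y.1 * Y.2 * (e₀.1 * c₀.2))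
          - trace (m.1 * m.2 * (c₁.1 * e₁.2)) + trace (e₀.1 * m.2 * (c₁.1 * Y.2)) := by
    simp only [Matrix.mul_sub, Matrix.sub_mul, trace_sub]
    rw [rot c₀.2, rot' c₀.2, rot m.2, rot m.2]
    ring
  rw [h1, h2]
  ring

/-- Half-dressing is a Poisson map: on covectors, the bivector of the dressing pair plus that of the
dressed pairs is the bivector of the collection they form. -/
theorem zakForm_dressPairs {n d : ℕ} (B : FactorizationBranch n) {m : SpinSpace n 1}
    (hm : m ∈ B.domain) (M : SpinSpace n d) (c e : SpinSpace n (d + 1))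
    {T T₂ : Matrix (Fin n) (Fin n) ℂ}
    (hT : T = dressShift (B.plus m)⁻¹ (B.minus m) (M.1 * (tailPairs n d c).2 * B.plus m)
      ((B.minus m)⁻¹ * (tailPairs n d c).1 * M.2))
    (hT₂ : T₂ = dressShift (B.plus m)⁻¹ (B.minus m) (M.1 * (tailPairs n d e).2 * B.plus m)
      ((B.minus m)⁻¹ * (tailPairs n d e).1 * M.2)) :
    zakForm (standardR n) (standardR 1) 1 m.1 m.2
        ((headPair n d c).2 + m.2 * T) ((headPair n d c).1 + T * m.1)
        ((headPair n d e).2 + m.2 * T₂) ((headPair n d e).1 + T₂ * m.1)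
      + zakForm (standardR n) (standardR d) 1 M.1 M.2
        ((tailPairs n d c).2 * B.plus m) ((B.minus m)⁻¹ * (tailPairs n d c).1)
        ((tailPairs n d e).2 * B.plus m) ((B.minus m)⁻¹ * (tailPairs n d e).1) =
    zakForm (standardR n) (standardR (d + 1)) 1
      (consPairs n d (m, dressPairs B m M)).1 (consPairs n d (m, dressPairs B m M)).2
      c.2 c.1 e.2 e.1 := by
  have hP := B.plus_mul_inv hm
  have hP2 := B.inv_mul_plus hm
  have hN := B.inv_mul_minus hm
  have hN2 := B.minus_mul_inv hm
  have key := trace_dressing_identity (B.plus_isUpperTriangular hm)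
    (B.inv_minus_isLowerTriangular hm) hP hP2 hN hN2 (B.factor m hm)
  have hsucc := two_mul_zakForm_succ (consPairs n d (m, dressPairs B m M)) c e
    (headPair_consPairs _) (tailPairs_consPairs _) rfl rfl rfl rfl
  refine mul_left_cancel₀ (two_ne_zero (α := ℂ)) ?_
  rw [hsucc, mul_add, zakForm_eq_trace, zakForm_eq_trace]
  generalize headPair n d c = c₀ at *
  generalize tailPairs n d c = c₁ at *
  generalize headPair n d e = e₀ at *
  generalize tailPairs n d e = e₁ at *
  clear hsucc
  specialize key (m.1 * c₀.2) (m.1 * e₀.2) (c₀.1 * m.2) (e₀.1 * m.2) (c₀.1 * e₀.2) (e₀.1 * c₀.2)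
    ((dressPairs B m M).1 * (dressPairs B m M).2) (c₁.1 * e₁.2) (e₁.1 * c₁.2) _ _ _ _
    ((dressPairs B m M).1 * c₁.2) ((dressPairs B m M).1 * e₁.2)
    (c₁.1 * (dressPairs B m M).2) (e₁.1 * (dressPairs B m M).2) T T₂ ?_ ?_ ?_ ?_ hT hT₂
  · simp only [dressPairs, Matrix.mul_assoc, hP, Matrix.mul_one]
  · simp only [dressPairs, Matrix.mul_assoc, hP, Matrix.mul_one]
  · simp only [dressPairs, ← Matrix.mul_assoc, hN2, Matrix.one_mul]
  · simp only [dressPairs, ← Matrix.mul_assoc, hN2, Matrix.one_mul]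
  -- the `R_d` term is not affected by half-dressing
  have hd (f : SpinSpace n d) : f.2 * (dressPairs B m M).1 - (dressPairs B m M).2 * f.1 =
      f.2 * B.plus m * M.1 - M.2 * ((B.minus m)⁻¹ * f.1) := by
    simp only [dressPairs, Matrix.mul_assoc]
  have hQ : trace (M.1 * M.2 * ((B.minus m)⁻¹ * c₁.1 * (e₁.2 * B.plus m)
        - (B.minus m)⁻¹ * e₁.1 * (c₁.2 * B.plus m))) =
      trace ((dressPairs B m M).1 * (dressPairs B m M).2 * (c₁.1 * e₁.2 - e₁.1 * c₁.2)) := by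
    have : (dressPairs B m M).1 * (dressPairs B m M).2 * (c₁.1 * e₁.2 - e₁.1 * c₁.2) =
        B.plus m * (M.1 * M.2 * (B.minus m)⁻¹ * (c₁.1 * e₁.2 - e₁.1 * c₁.2)) := by
      simp only [dressPairs, Matrix.mul_assoc]
    rw [this, trace_mul_comm (B.plus m)]
    simp only [Matrix.mul_sub, Matrix.sub_mul, Matrix.mul_assoc]
  have hl : trace ((B.minus m)⁻¹ * e₁.1 * (c₁.2 * B.plus m)
        - (B.minus m)⁻¹ * c₁.1 * (e₁.2 * B.plus m)) =
      trace (B.plus m * (B.minus m)⁻¹ * (e₁.1 * c₁.2 - c₁.1 * e₁.2)) := by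
    rw [Matrix.mul_assoc (B.plus m), trace_mul_comm (B.plus m)]
    simp only [Matrix.mul_sub, Matrix.sub_mul, Matrix.mul_assoc]
  have hC (c₀ e₀ : SpinSpace n 1) (T T₂ : Matrix (Fin n) (Fin n) ℂ) :
      (c₀.1 + T * m.1) * (e₀.2 + m.2 * T₂) =
        c₀.1 * e₀.2 + T * (m.1 * e₀.2) + c₀.1 * m.2 * T₂ + T * (m.1 * m.2) * T₂ := by
    simp only [Matrix.add_mul, Matrix.mul_add, Matrix.mul_assoc]
    abel
  have hA (c₀ : SpinSpace n 1) (T : Matrix (Fin n) (Fin n) ℂ) :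
      m.1 * (c₀.2 + m.2 * T) = m.1 * c₀.2 + m.1 * m.2 * T := by
    rw [Matrix.mul_add, Matrix.mul_assoc]
  have hB (c₀ : SpinSpace n 1) (T : Matrix (Fin n) (Fin n) ℂ) :
      (c₀.1 + T * m.1) * m.2 = c₀.1 * m.2 + T * (m.1 * m.2) := by
    rw [Matrix.add_mul, Matrix.mul_assoc]
  simp only [hQ, hl, hA, hB, hC, hd, standardR_one, Matrix.mul_zero, trace_zero,
    ← Matrix.mul_assoc M.1] at key ⊢
  linear_combination key

/-! ### The sequential half-dressing map -/

/-- The head of the half-dressing map is the first pair; its tail is half-dressed by it. -/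
theorem halfDressing_succ {n d : ℕ} (B : Fin (d + 1) → FactorizationBranch n)
    (x : Fin (d + 1) → SpinSpace n 1) :
    halfDressing B x =
      consPairs n d (x 0, dressPairs (B 0) (x 0) (halfDressing (Fin.tail B) (Fin.tail x))) := by
  refine Prod.ext ?_ ?_
  · ext i k; refine Fin.cases ?_ (fun k => ?_) k <;> rfl
  · ext k i; refine Fin.cases ?_ (fun k => ?_) k <;> rfl

theorem tail_mem_dressingDomain {n d : ℕ} {B : Fin (d + 1) → FactorizationBranch n}
    {x : Fin (d + 1) → SpinSpace n 1} (hx : x ∈ dressingDomain B) :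
    Fin.tail x ∈ dressingDomain (Fin.tail B) := fun k => hx k.succ

theorem isOpen_dressingDomain {n d : ℕ} (B : Fin d → FactorizationBranch n) :
    IsOpen (dressingDomain B) := by
  have : dressingDomain B = ⋂ k, (fun x : Fin d → SpinSpace n 1 => x k) ⁻¹' (B k).domain := by
    ext x; simp [dressingDomain]
  rw [this]
  exact isOpen_iInter_of_finite fun k => (B k).isOpen_domain.preimage (continuous_apply k)

theorem differentiableAt_halfDressing {n : ℕ} : ∀ {d : ℕ} (B : Fin d → FactorizationBranch n)
    {x : Fin d → SpinSpace n 1}, x ∈ dressingDomain B → DifferentiableAt ℂ (halfDressing B) x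
  | 0, B, x, _ => by
    have : halfDressing B = fun _ => halfDressing B x :=
      funext fun y => by rw [Subsingleton.elim y x]
    rw [this]
    exact differentiableAt_const _
  | d + 1, B, x, hx => by
    have h0 : DifferentiableAt ℂ (fun y : Fin (d + 1) → SpinSpace n 1 => y 0) x :=
      differentiableAt_apply 0 x
    have ht : DifferentiableAt ℂ (fun y : Fin (d + 1) → SpinSpace n 1 => Fin.tail y) x :=
      differentiableAt_pi.2 fun k => differentiableAt_apply k.succ x
    have ih := differentiableAt_halfDressing (Fin.tail B) (tail_mem_dressingDomain hx)
    have h1 := h0.prodMk (DifferentiableAt.dressPairs (B 0) h0 (ih.comp x ht) (hx 0))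
    rw [funext (halfDressing_succ B)]
    exact (consPairs n d).differentiableAt.comp x h1

/-- The half-dressing map is undone one pair at a time: the first pair is read off, and the others
are undressed by it. -/
theorem exists_halfDressing_inverse {n : ℕ} : ∀ {d : ℕ} (B : Fin d → FactorizationBranch n),
    ∃ E : SpinSpace n d → (Fin d → SpinSpace n 1),
      IsOpen (halfDressing B '' dressingDomain B) ∧
      DifferentiableOn ℂ E (halfDressing B '' dressingDomain B) ∧
      Set.LeftInvOn E (halfDressing B) (dressingDomain B)
  | 0, B => by
    refine ⟨fun _ => 0, isOpen_discrete _, differentiableOn_const _,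
      fun x _ => Subsingleton.elim _ _⟩
  | d + 1, B => by
    obtain ⟨E, hopen, hdiff, hinv⟩ := exists_halfDressing_inverse (Fin.tail B)
    let u : SpinSpace n (d + 1) → SpinSpace n d := fun y =>
      undressPairs (B 0) (headPair n d y) (tailPairs n d y)
    have hu : ∀ y, headPair n d y ∈ (B 0).domain → DifferentiableAt ℂ u y := fun y hy =>
      DifferentiableAt.undressPairs (B 0) (headPair n d).differentiableAt
        (tailPairs n d).differentiableAt hy
    have himage : halfDressing B '' dressingDomain B =
        headPair n d ⁻¹' (B 0).domain ∩
          u ⁻¹' (halfDressing (Fin.tail B) '' dressingDomain (Fin.tail B)) := by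
      ext y
      constructor
      · rintro ⟨x, hx, rfl⟩
        refine ⟨?_, Fin.tail x, tail_mem_dressingDomain hx, ?_⟩
        · rw [Set.mem_preimage, halfDressing_succ, headPair_consPairs]
          exact hx 0
        · simp only [u, halfDressing_succ, headPair_consPairs, tailPairs_consPairs]
          rw [undressPairs_dressPairs _ (hx 0)]
      · rintro ⟨hy, x, hx, hxy⟩
        refine ⟨Fin.cons (headPair n d y) x, fun k => ?_, ?_⟩
        · refine Fin.cases ?_ (fun k => ?_) k
          · exact hy
          · exact hx k
        · rw [halfDressing_succ]
          simp only [Fin.cons_zero, Fin.tail_cons, hxy, u]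
          rw [dressPairs_undressPairs _ hy, consPairs_head_tail]
    have hdom : IsOpen (headPair n d ⁻¹' (B 0).domain) :=
      (B 0).isOpen_domain.preimage (headPair n d).continuous
    refine ⟨fun y => Fin.cons (headPair n d y) (E (u y)), ?_, ?_, ?_⟩
    · rw [himage]
      exact ContinuousOn.isOpen_inter_preimage
        (fun y hy => (hu y hy).continuousAt.continuousWithinAt) hdom hopen
    · rw [himage]
      rintro y ⟨hy, hy'⟩
      refine DifferentiableAt.differentiableWithinAt (differentiableAt_pi.2 fun k => ?_)
      have hE := ((hdiff _ hy').differentiableAt (hopen.mem_nhds hy')).comp y (hu y hy)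
      refine Fin.cases ?_ (fun k => ?_) k
      · exact (headPair n d).differentiableAt
      · exact differentiableAt_pi.1 hE k
    · intro x hx
      have h1 := hinv (tail_mem_dressingDomain hx)
      simp only [u, halfDressing_succ, headPair_consPairs, tailPairs_consPairs]
      rw [undressPairs_dressPairs _ (hx 0), h1, Fin.cons_self_tail]

/-- The half-dressing map is Poisson: its first slot is the dressing pair, and the other slots are
covered by the half-dressing map of one pair less. -/
theorem directSumBracket_comp_halfDressing {n : ℕ} : ∀ {d : ℕ} (B : Fin d → FactorizationBranch n)
    {x : Fin d → SpinSpace n 1}, x ∈ dressingDomain B → ∀ {F H : SpinSpace n d → ℂ},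
    DifferentiableAt ℂ F (halfDressing B x) → DifferentiableAt ℂ H (halfDressing B x) →
      directSumBracket (F ∘ halfDressing B) (H ∘ halfDressing B) x =
        zakBracket (standardR n) (standardR d) 1 F H (halfDressing B x)
  | 0, B, x, _, F, H, _, _ => by
    have h0 (c z : SpinSpace n 0) : c.1 * z.2 = 0 := by
      ext i j
      simp [Matrix.mul_apply]
    rw [zakBracket_eq_spinGrad]
    refine Eq.symm (mul_left_cancel₀ (two_ne_zero (α := ℂ)) ?_)
    rw [zakForm_eq_trace]
    simp [h0, directSumBracket, trace]
  | d + 1, B, x, hx, F, H, hF, hH => by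
    have ht := tail_mem_dressingDomain hx
    set M := halfDressing (Fin.tail B) (Fin.tail x) with hM
    have hD := halfDressing_succ B x
    rw [← hM] at hD
    rw [hD] at hF hH
    have hr := differentiableAt_dressPairs_right (B 0) (x 0) M
    have hcomp {F : SpinSpace n (d + 1) → ℂ}
        (hF : DifferentiableAt ℂ F (consPairs n d (x 0, dressPairs (B 0) (x 0) M))) :
        DifferentiableAt ℂ (fun M => F (consPairs n d (x 0, dressPairs (B 0) (x 0) M))) M :=
      hF.comp M ((consPairs n d).differentiableAt.comp M ((differentiableAt_const _).prodMk hr))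
    have ih := directSumBracket_comp_halfDressing (Fin.tail B) ht (hcomp hF) (hcomp hH)
    have hzero (F : SpinSpace n (d + 1) → ℂ) :
        (fun m => (F ∘ halfDressing B) (Function.update x 0 m)) =
          fun m => F (consPairs n d (m, dressPairs (B 0) m M)) := by
      funext m
      rw [Function.comp_apply, halfDressing_succ, Function.update_self, Fin.tail_update_zero]
    have hsucc (F : SpinSpace n (d + 1) → ℂ) (k : Fin d) :
        (fun m => (F ∘ halfDressing B) (Function.update x k.succ m)) =
          fun m => ((fun M => F (consPairs n d (x 0, dressPairs (B 0) (x 0) M))) ∘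
            halfDressing (Fin.tail B)) (Function.update (Fin.tail x) k m) := by
      funext m
      rw [Function.comp_apply, halfDressing_succ, Fin.tail_update_succ,
        Function.update_of_ne (Fin.succ_ne_zero k).symm]
      rfl
    rw [directSumBracket, Fin.sum_univ_succ]
    simp only [hzero, hsucc]
    change _ + directSumBracket _ _ (Fin.tail x) = _
    rw [ih, hD, ← hM, zakBracket_eq_spinGrad, zakBracket_eq_spinGrad, zakBracket_eq_spinGrad,
      spinGrad_comp_dressPairs_left (B 0) (hx 0) hF rfl rfl,
      spinGrad_comp_dressPairs_left (B 0) (hx 0) hH rfl rfl,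
      spinGrad_comp_dressPairs_right (B 0) hF, spinGrad_comp_dressPairs_right (B 0) hH]
    exact zakForm_dressPairs (B 0) (hx 0) M _ _ rfl rfl

theorem proposition6p1 (n d : ℕ) (B : Fin d → FactorizationBranch n) :
    IsOpen (dressingDomain B) ∧
    DifferentiableOn ℂ (halfDressing B) (dressingDomain B) ∧
    Set.InjOn (halfDressing B) (dressingDomain B) ∧
    IsOpen (halfDressing B '' dressingDomain B) ∧
    DifferentiableOn ℂ (Function.invFunOn (halfDressing B) (dressingDomain B))
      (halfDressing B '' dressingDomain B) ∧
    ∀ y ∈ halfDressing B '' dressingDomain B, ∀ F H : SpinSpace n d → ℂ,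
      DifferentiableAt ℂ F y → DifferentiableAt ℂ H y →
        engenderedBracket (halfDressing B) (dressingDomain B) F H y =
          zakBracket (standardR n) (standardR d) 1 F H y := by
  obtain ⟨E, hopen, hdiff, hinv⟩ := exists_halfDressing_inverse B
  refine ⟨isOpen_dressingDomain B,
    fun x hx => (differentiableAt_halfDressing B hx).differentiableWithinAt, hinv.injOn, hopen,
    hdiff.congr ?_, ?_⟩
  · rintro _ ⟨x, hx, rfl⟩
    rw [hinv.injOn.leftInvOn_invFunOn hx, hinv hx]
  · rintro _ ⟨x, hx, rfl⟩ F H hF hH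
    rw [engenderedBracket, hinv.injOn.leftInvOn_invFunOn hx]
    exact directSumBracket_comp_halfDressing B hx hF hH
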